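/- Let $N\ge 2$ sensors move in $\mathbb{R}^2$; let $\mathbf{x}=(x_1,\dots,x_N)$, $x_i\in\mathbb{R}^2$. Sensor $i$ has the cost $$f_i(\mathbf{x})=x_i^Tr_{ii}x_i+x_i^Tr_i+b_i+\sum_{j\in\mathcal{N}_i^p}c_{ij}\|x_i-x_j\|^2,$$ where $r_{ii}\in\mathbb{R}^{2\times2}$ is symmetric positive definite and strictly diagonally dominant, $r_i\in\mathbb{R}^2$, $b_i\in\mathbb{R}$, $\mathcal{N}_i^p\subseteq\{1,\dots,N\}$ is the set of physical neighbors of $i$, and $c_{ij}>0$ for $j\in\mathcal{N}_i^p$. Let $a_{ij}=a_{ji}\ge 0$, $a_{ii}=0$, be the adjacency weights of a connected undirected communication graph (with an edge between $i$ and $j$ exactly if $a_{ij}>0$). Let $t_0\in\mathbb{R}$, and let the disturbances $d_i:[t_0,\infty)\to\mathbb{R}^2$ be continuously differentiable with bounded derivative. Let $\bar\theta_{ij},k_{i1},k_{i2}$ be fixed positive constants. For gains $\theta,\sigma>0$, consider for $t\ge t_0$ the closed loop $$\dot x_i=u_i+d_i(t),\qquad u_i=-\frac{\partial f_i}{\partial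 x_i}(\mathbf{y}_i)-\hat z_i,\qquad \mathbf{y}_i=(y_{i1},\dots,y_{iN}),$$ $$\dot y_{ij}=-\theta\bar\theta_{ij}\Big(\sum_{k=1}^N a_{ik}(y_{ij}-y_{kj})+a_{ij}(y_{ij}-x_j)\Big),$$ $$\dot{\hat x}_i=u_i+\hat z_i+\sigma k_{i1}(x_i-\hat x_i),\qquad \dot{\hat z}_i=\sigma^2k_{i2}(x_i-\hat x_i),$$ with all variables $x_i,y_{ij},\hat x_i,\hat z_i$ in $\mathbb{R}^2$ and with arbitrary initial values. Then the game has a unique Nash equilibrium $\mathbf{x}^*$, that is, a unique profile with $f_i(\mathbf{x}^*)\le f_i(x_i,\mathbf{x}^*_{-i})$ for all $i$ and all $x_i\in\mathbb{R}^2$. Let $\mathcal{E}(t)$ be the concatenation of all the vectors $x_i-\hat x_i$, $d_i(t)-\hat z_i$, $y_{ij}-x_j$ and $x_i-x_i^*$ at time $t$, with the Euclidean norm. There is a constant $\theta^*>0$ such that for every $v_1>0$ there is a constant $\sigma^*=\sigma^*(v_1)>0$, neither of them depending on the initial values, such that for all $\theta\in(\theta^*,\infty)$ and $\sigma\in(\sigma^*,\infty)$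 and every solution of the closed loop on $[t_0,\infty)$ there is a $\bar T\ge t_0$ with $$\|\mathcal{E}(t)\|\le v_1\qquad\text{for all } t>\bar T.$$ -/

import Mathlib

/-- The plane `ℝ²` with the Euclidean norm, in which the sensors move. -/
abbrev Plane : Type := EuclideanSpace ℝ (Fin 2)

/-- The data of the mobile-sensor connectivity game with `N` sensors: the local cost
`x_iᵀ r_ii x_i + x_iᵀ r_i + b_i` of each sensor, its set of physical neighbours, and the positive
weights `c_ij` of the coupling costs `c_ij ‖x_i - x_j‖²`. -/
structure SensorGame (N : ℕ) where
  /-- the matrices `r_ii` -/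
  quad : Fin N → Matrix (Fin 2) (Fin 2) ℝ
  /-- the vectors `r_i` -/
  lin : Fin N → Plane
  /-- the constants `b_i` -/
  const : Fin N → ℝ
  /-- the physical neighbour sets -/
  physNbr : Fin N → Finset (Fin N)
  /-- the coupling weights `c_ij` -/
  c : Fin N → Fin N → ℝ
  /-- each `r_ii` is symmetric positive definite -/
  quad_posDef : ∀ i, (quad i).PosDef
  /-- each `r_ii` is strictly diagonally dominant -/
  quad_diagDom : ∀ i k, ∑ l ∈ Finset.univ.erase k, |quad i k l| < |quad i k k|
  c_pos : ∀ i, ∀ j ∈ physNbr i, 0 < c i j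

/-- A weighted undirected communication graph on `N` nodes, given by its adjacency matrix: there
is an edge between `i` and `j` exactly if `a i j > 0`. -/
structure CommGraph (N : ℕ) where
  a : Fin N → Fin N → ℝ
  nonneg : ∀ i j, 0 ≤ a i j
  symm : ∀ i j, a i j = a j i
  diag : ∀ i, a i i = 0

/-- The underlying simple graph of a weighted communication graph. -/
def CommGraph.toSimpleGraph {N : ℕ} (A : CommGraph N) : SimpleGraph (Fin N) where
  Adj i j := 0 < A.a i j
  symm := ⟨fun i j h => by rw [A.symm j i]; exact h⟩
  loopless := ⟨fun i h => by rw [A.diag i] at h; exact lt_irrefl _ h⟩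

/-- The fixed positive parameters of the strategy. -/
structure FixedGains (N : ℕ) where
  thetaBar : Fin N → Fin N → ℝ
  k₁ : Fin N → ℝ
  k₂ : Fin N → ℝ
  thetaBar_pos : ∀ i j, 0 < thetaBar i j
  k₁_pos : ∀ i, 0 < k₁ i
  k₂_pos : ∀ i, 0 < k₂ i

namespace SensorGame

variable {N : ℕ}

/-- The local cost `l_i^c(v) = vᵀ r_ii v + vᵀ r_i + b_i`. -/
noncomputable def localCost (G : SensorGame N) (i : Fin N) (v : Plane) : ℝ :=
  (∑ k, ∑ l, v k * G.quad i k l * v l) + (∑ k, v k * G.lin i k) + G.const i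

/-- The cost `f_i` of sensor `i`. -/
noncomputable def cost (G : SensorGame N) (i : Fin N) (x : Fin N → Plane) : ℝ :=
  G.localCost i (x i) + ∑ j ∈ G.physNbr i, G.c i j * ‖x i - x j‖ ^ 2

/-- The partial gradient `∂f_i/∂x_i`, a vector of `ℝ²`, at the profile `x`. -/
noncomputable def partialGrad (G : SensorGame N) (i : Fin N) (x : Fin N → Plane) : Plane :=
  gradient (fun v : Plane => G.cost i (Function.update x i v)) (x i)

/-- `x` is a Nash equilibrium: no sensor lowers its cost by changing its own position only. -/
def IsNash (G : SensorGame N) (x : Fin N → Plane) : Prop :=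
  ∀ (i : Fin N) (v : Plane), G.cost i x ≤ G.cost i (Function.update x i v)

end SensorGame

/-- The state of the closed loop: positions `x_i`, observer states `x̂_i` and `ẑ_i`, and the
estimates `y_ij` by sensor `i` of the position of sensor `j`. -/
structure LoopState (N : ℕ) where
  x : Fin N → Plane
  xhat : Fin N → Plane
  zhat : Fin N → Plane
  y : Fin N → Fin N → Plane

/-- The control law `u_i = -∂f_i/∂x_i(y_i) - ẑ_i`. -/
noncomputable def piControl {N : ℕ} (G : SensorGame N) (S : LoopState N) (i : Fin N) : Plane :=
  -G.partialGrad i (S.y i) - S.zhat i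

/-- `S` solves the closed loop of `ẋ_i = u_i + d_i(t)` with the PI-based strategy with gains
`θ`, `σ` on `[t₀, ∞)`, from arbitrary initial values. -/
structure IsTrajectory {N : ℕ} (G : SensorGame N) (A : CommGraph N) (K : FixedGains N)
    (d : Fin N → ℝ → Plane) (t₀ θ σ : ℝ) (S : ℝ → LoopState N) : Prop where
  x_eq : ∀ t, t₀ ≤ t → ∀ i,
    HasDerivWithinAt (fun s => (S s).x i) (piControl G (S t) i + d i t) (Set.Ici t₀) t
  y_eq : ∀ t, t₀ ≤ t → ∀ i j,
    HasDerivWithinAt (fun s => (S s).y i j)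
      (-((θ * K.thetaBar i j) •
        ((∑ k, A.a i k • ((S t).y i j - (S t).y k j)) + A.a i j • ((S t).y i j - (S t).x j))))
      (Set.Ici t₀) t
  xhat_eq : ∀ t, t₀ ≤ t → ∀ i,
    HasDerivWithinAt (fun s => (S s).xhat i)
      (piControl G (S t) i + (S t).zhat i + (σ * K.k₁ i) • ((S t).x i - (S t).xhat i))
      (Set.Ici t₀) t
  zhat_eq : ∀ t, t₀ ≤ t → ∀ i,
    HasDerivWithinAt (fun s => (S s).zhat i)
      ((σ ^ 2 * K.k₂ i) • ((S t).x i - (S t).xhat i)) (Set.Ici t₀) t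

/-- The concatenated error vector, with the Euclidean norm. Its blocks, each in `ℝ²`, are
`ζ_i1 = x_i - x̂_i`, `ζ_i2 = d_i(t) - ẑ_i`, `η_ij = y_ij - x_j` and `ξ_i = x_i - x_i^*`. -/
noncomputable def errorVec {N : ℕ} (xs : Fin N → Plane) (d : Fin N → ℝ → Plane)
    (S : ℝ → LoopState N) (t : ℝ) :
    PiLp 2 (fun _ : (Fin N ⊕ Fin N) ⊕ (Fin N × Fin N) ⊕ Fin N => Plane) :=
  WithLp.toLp 2
    (Sum.elim
      (Sum.elim (fun i => (S t).x i - (S t).xhat i) (fun i => d i t - (S t).zhat i))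
      (Sum.elim (fun p => (S t).y p.1 p.2 - (S t).x p.2) (fun i => (S t).x i - xs i)))

/-!
The pseudo-gradient is affine, and its linear part dominates the matrix with diagonal entries
`2 λᵢ + ∑ⱼ cᵢⱼ` and off-diagonal entries `-cᵢⱼ`, where `λᵢ > 0` bounds `rᵢᵢ` from below. This is a
nonsingular M-matrix, so weighting the players by the column sums of its nonnegative inverse makes
the pseudo-gradient strongly monotone although the couplings are not symmetric. Hence there is a
unique equilibrium, and it attracts the positions `x` in the weighted norm. The graph Laplacian
pinned at the neighbours of `j` is positive definite, so the errors of the estimates of `xⱼ` decay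
at a rate proportional to `θ`. The observer errors `p = σ (x - x̂)` and `q = d - ẑ` satisfy
`ṗ = σ (q - k₁ p)` and `q̇ = ḋ - σ k₂ p`, a stable linear system of rate `σ` whose Lyapunov equation
is solved explicitly. Once `θ` and `σ` dominate the cross terms, the sum `V` of the three quadratic
Lyapunov functions satisfies `V̇ ≤ -‖e‖² + C ∑ᵢ ‖ḋᵢ‖² / σ`, and the resulting ultimate bound
vanishes as `σ → ∞`.
-/

open Filter Finset
open scoped InnerProductSpace NNReal Matrix MatrixOrder Topology

theorem exists_pos_mul_dotProduct_le_of_posDef {ι : Type*} [Fintype ι] {M : Matrix ι ι ℝ}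
    (hM : M.PosDef) : ∃ m : ℝ, 0 < m ∧ ∀ z : ι → ℝ, m * (z ⬝ᵥ z) ≤ z ⬝ᵥ M *ᵥ z := by
  classical
  cases isEmpty_or_nonempty ι
  · exact ⟨1, one_pos, fun z => by simp [dotProduct]⟩
  have hM' : IsStrictlyPositive M := Matrix.isStrictlyPositive_iff_posDef.2 hM
  obtain ⟨m, hm, hle⟩ :=
    (CFC.exists_pos_algebraMap_le_iff hM'.isSelfAdjoint).2 fun _ hx => hM'.spectrum_pos hx
  refine ⟨m, hm, fun z => ?_⟩
  have hnonneg : 0 ≤ z ⬝ᵥ (M - algebraMap ℝ _ m) *ᵥ z := by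
    simpa using (Matrix.le_iff.1 hle).dotProduct_mulVec_nonneg z
  rwa [Matrix.sub_mulVec, dotProduct_sub, Algebra.algebraMap_eq_smul_one, Matrix.smul_mulVec,
    Matrix.one_mulVec, dotProduct_smul, smul_eq_mul, sub_nonneg] at hnonneg

theorem eventually_le_of_hasDerivWithinAt_le_neg_mul_add {U U' : ℝ → ℝ} {t₀ α ε b : ℝ}
    (hα : 0 < α) (hb : ε / α < b)
    (hderiv : ∀ t, t₀ ≤ t → HasDerivWithinAt U (U' t) (Set.Ici t₀) t)
    (hle : ∀ t, t₀ ≤ t → U' t ≤ -α * U t + ε) : ∀ᶠ t in atTop, U t ≤ b := by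
  have hbound : ∀ t, t₀ ≤ t → U t ≤ gronwallBound (U t₀) (-α) ε (t - t₀) := fun t ht =>
    le_gronwallBound_of_liminf_deriv_right_le
      (fun s hs => ((hderiv s hs.1).continuousWithinAt).mono Set.Icc_subset_Ici_self)
      (fun s hs r hr => ((hderiv s hs.1).mono (Set.Ici_subset_Ici.2 hs.1)).liminf_right_slope_le hr)
      le_rfl (fun s hs => hle s hs.1) t ⟨ht, le_rfl⟩
  have hlim : Tendsto (fun t => gronwallBound (U t₀) (-α) ε (t - t₀)) atTop (𝓝 (ε / α)) := by
    have hexp : Tendsto (fun t => Real.exp (-α * (t - t₀))) atTop (𝓝 0) :=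
      Real.tendsto_exp_atBot.comp <| (tendsto_atTop_add_const_right _ (-t₀)
        tendsto_id).const_mul_atTop_of_neg (neg_lt_zero.2 hα)
    simp only [gronwallBound_of_K_ne_0 (neg_ne_zero.2 hα.ne')]
    convert (hexp.const_mul (U t₀)).add ((hexp.sub_const 1).const_mul (ε / -α)) using 2
    field_simp
    ring
  filter_upwards [eventually_ge_atTop t₀, hlim.eventually_lt_const hb] with t ht hlt
  exact (hbound t ht).trans hlt.le

theorem two_mul_inner_le_mul_sq_add_sq_div {E : Type*} [SeminormedAddCommGroup E]
    [InnerProductSpace ℝ E] (u v : E) {s : ℝ} (hs : 0 < s) :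
    2 * ⟪u, v⟫_ℝ ≤ s * ‖u‖ ^ 2 + ‖v‖ ^ 2 / s := by
  have hsq : 0 ≤ ‖s • u - v‖ ^ 2 / s := by positivity
  rw [norm_sub_sq_real, norm_smul, Real.norm_of_nonneg hs.le, real_inner_smul_left] at hsq
  have hexpand : ((s * ‖u‖) ^ 2 - 2 * (s * ⟪u, v⟫_ℝ) + ‖v‖ ^ 2) / s =
      s * ‖u‖ ^ 2 - 2 * ⟪u, v⟫_ℝ + ‖v‖ ^ 2 / s := by
    field_simp
  linarith

section ScreenedLaplacian

variable {ι : Type*} [Fintype ι] [DecidableEq ι]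

/-- The Laplacian of a network with edge weights `c`, plus a diagonal leakage term `l`. -/
def screenedLaplacian (l : ι → ℝ) (c : ι → ι → ℝ) : Matrix ι ι ℝ :=
  Matrix.diagonal (fun i => l i + ∑ j, c i j) - Matrix.of c

variable {l : ι → ℝ} {c : ι → ι → ℝ}

theorem screenedLaplacian_mulVec_apply (y : ι → ℝ) (i : ι) :
    (screenedLaplacian l c *ᵥ y) i = l i * y i + ∑ j, c i j * (y i - y j) := by
  rw [screenedLaplacian, Matrix.sub_mulVec, Pi.sub_apply, Matrix.mulVec_diagonal, add_mul, sum_mul,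
    add_sub_assoc]
  simp only [Matrix.mulVec, dotProduct, Matrix.of_apply, mul_sub, sum_sub_distrib]

theorem nonneg_of_screenedLaplacian_mulVec_nonneg (hl : ∀ i, 0 < l i) (hc : ∀ i j, 0 ≤ c i j)
    {y : ι → ℝ} (hy : 0 ≤ screenedLaplacian l c *ᵥ y) : 0 ≤ y := by
  intro i
  obtain ⟨k, -, hk⟩ := exists_min_image univ y ⟨i, mem_univ i⟩
  refine le_trans ?_ (hk i (mem_univ i))
  by_contra! hneg
  have hdiff : ∑ j, c k j * (y k - y j) ≤ 0 := sum_nonpos fun j _ =>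
    mul_nonpos_of_nonneg_of_nonpos (hc k j) (sub_nonpos.2 (hk j (mem_univ j)))
  have hky := hy k
  rw [screenedLaplacian_mulVec_apply] at hky
  exact hky.not_gt (add_neg_of_neg_of_nonpos (mul_neg_of_pos_of_neg (hl k) hneg) hdiff)

theorem isUnit_screenedLaplacian (hl : ∀ i, 0 < l i) (hc : ∀ i j, 0 ≤ c i j) :
    IsUnit (screenedLaplacian l c) := by
  refine Matrix.mulVec_injective_iff_isUnit.1
    ((injective_iff_map_eq_zero (screenedLaplacian l c).mulVecLin).2 fun y hy => ?_)
  rw [Matrix.mulVecLin_apply] at hy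
  refine le_antisymm (neg_nonneg.1 ?_) (nonneg_of_screenedLaplacian_mulVec_nonneg hl hc hy.ge)
  exact nonneg_of_screenedLaplacian_mulVec_nonneg hl hc (by rw [Matrix.mulVec_neg, hy, neg_zero])

-- `w` collects the column sums of the entrywise nonnegative inverse.
theorem exists_pos_vecMul_screenedLaplacian_eq_one (hl : ∀ i, 0 < l i) (hc : ∀ i j, 0 ≤ c i j) :
    ∃ w : ι → ℝ, (∀ i, 0 < w i) ∧ w ᵥ* screenedLaplacian l c = 1 := by
  have hdet := (Matrix.isUnit_iff_isUnit_det _).1 (isUnit_screenedLaplacian hl hc)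
  refine ⟨1 ᵥ* (screenedLaplacian l c)⁻¹, fun j => ?_, by
    rw [Matrix.vecMul_vecMul, Matrix.nonsing_inv_mul _ hdet, Matrix.vecMul_one]⟩
  set y : ι → ℝ := (screenedLaplacian l c)⁻¹ *ᵥ Pi.single j 1 with hy
  have hLy : screenedLaplacian l c *ᵥ y = Pi.single j 1 := by
    rw [hy, Matrix.mulVec_mulVec, Matrix.mul_nonsing_inv _ hdet, Matrix.one_mulVec]
  have hy0 : 0 ≤ y := nonneg_of_screenedLaplacian_mulVec_nonneg hl hc <| by
    rw [hLy]
    exact Pi.single_nonneg.2 zero_le_one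
  have hyne : y ≠ 0 := fun h => by simp [h, eq_comm] at hLy
  calc (0 : ℝ) < 1 ⬝ᵥ y := by
        rw [one_dotProduct]
        exact sum_pos' (fun i _ => hy0 i) (by
          obtain ⟨i, hi⟩ := Function.ne_iff.1 hyne
          exact ⟨i, mem_univ i, (hy0 i).lt_of_ne' hi⟩)
    _ = (1 ᵥ* (screenedLaplacian l c)⁻¹) j := by
        rw [hy, Matrix.dotProduct_mulVec, dotProduct_single_one]

end ScreenedLaplacian

theorem sum_inner_smul_add_sum_smul_sub {ι E : Type*} [Fintype ι] [SeminormedAddCommGroup E]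
    [InnerProductSpace ℝ E] {l : ι → ℝ} {c : ι → ι → ℝ} (hc : ∀ i j, c i j = c j i) (z : ι → E) :
    ∑ i, ⟪z i, l i • z i + ∑ j, c i j • (z i - z j)⟫_ℝ =
      ∑ i, l i * ‖z i‖ ^ 2 + (∑ i, ∑ j, c i j * ‖z i - z j‖ ^ 2) / 2 := by
  have hswap : ∑ i, ∑ j, c i j * ⟪z i, z i - z j⟫_ℝ = ∑ i, ∑ j, c i j * ⟪z j, z j - z i⟫_ℝ := by
    rw [sum_comm]
    exact sum_congr rfl fun i _ => sum_congr rfl fun j _ => by rw [hc j i]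
  have hpair : ∀ i j, c i j * ‖z i - z j‖ ^ 2 =
      c i j * ⟪z i, z i - z j⟫_ℝ + c i j * ⟪z j, z j - z i⟫_ℝ := fun i j => by
    rw [← mul_add, ← real_inner_self_eq_norm_sq, inner_sub_left, ← neg_sub (z i) (z j),
      inner_neg_right, sub_eq_add_neg]
  simp only [hpair, sum_add_distrib, ← hswap, inner_add_right, inner_sum, real_inner_smul_right,
    real_inner_self_eq_norm_sq]
  ring

namespace CommGraph

variable {N : ℕ} (A : CommGraph N)

theorem posDef_screenedLaplacian (hA : A.toSimpleGraph.Connected) {l : Fin N → ℝ}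
    (hl : ∀ i, 0 ≤ l i) (hpos : ∃ i, 0 < l i) : (screenedLaplacian l A.a).PosDef := by
  refine .of_dotProduct_mulVec_pos ?_ fun y hy => ?_
  · ext i j
    by_cases h : i = j
    · simp [screenedLaplacian, h]
    · simp [screenedLaplacian, h, Ne.symm h, A.symm i j]
  have henergy : star y ⬝ᵥ screenedLaplacian l A.a *ᵥ y =
      ∑ i, l i * y i ^ 2 + (∑ i, ∑ j, A.a i j * (y i - y j) ^ 2) / 2 := by
    simpa [dotProduct, screenedLaplacian_mulVec_apply, mul_comm] using
      sum_inner_smul_add_sum_smul_sub A.symm (l := l) y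
  have hleak : ∀ i, 0 ≤ l i * y i ^ 2 := fun i => mul_nonneg (hl i) (sq_nonneg _)
  have hedge : ∀ i j, 0 ≤ A.a i j * (y i - y j) ^ 2 := fun i j =>
    mul_nonneg (A.nonneg i j) (sq_nonneg _)
  rw [henergy]
  by_contra! hle
  have hleak0 := sum_nonneg fun i (_ : i ∈ univ) => hleak i
  have hedge0 := sum_nonneg fun i (_ : i ∈ univ) => sum_nonneg fun j (_ : j ∈ univ) => hedge i j
  obtain ⟨k, hk⟩ := hpos
  have hyk : y k = 0 := by
    have := (sum_eq_zero_iff_of_nonneg fun i _ => hleak i).1 (by linarith) k (mem_univ k)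
    simpa [hk.ne'] using this
  have hadj : ∀ i j, A.toSimpleGraph.Adj i j → y i = y j := fun i j (hij : 0 < A.a i j) => by
    have hi := (sum_eq_zero_iff_of_nonneg fun i _ => sum_nonneg fun j _ => hedge i j).1
      (by linarith) i (mem_univ i)
    have := (sum_eq_zero_iff_of_nonneg fun j _ => hedge i j).1 hi j (mem_univ j)
    simpa [hij.ne', sub_eq_zero] using this
  have hconst : ∀ i, y i = y k := fun i => by
    obtain ⟨p⟩ := hA.preconnected i k
    induction p with
    | nil => rfl
    | cons h _ ih => exact (hadj _ _ h).trans (ih hk hyk)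
  exact hy (funext fun i => (hconst i).trans hyk)

theorem exists_adj (hN : 2 ≤ N) (hA : A.toSimpleGraph.Connected) (j : Fin N) :
    ∃ i, 0 < A.a i j := by
  have : Nontrivial (Fin N) := Fin.nontrivial_iff_two_le.2 hN
  obtain ⟨i, hij⟩ := hA.preconnected.exists_adj_of_nontrivial j
  exact ⟨i, by rwa [A.symm i j]⟩

/-- The linear map `z ↦ (∑ₖ aᵢₖ (zᵢ - zₖ) + aᵢⱼ zᵢ)ᵢ`, which drives the errors `z` of the estimates
of the position of sensor `j`: the Laplacian pinned at the neighbours of `j`. -/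
def pinnedLaplacian {E : Type*} [AddCommGroup E] [Module ℝ E] (j : Fin N) (z : Fin N → E)
    (i : Fin N) : E :=
  ∑ k, A.a i k • (z i - z k) + A.a i j • z i

theorem exists_pos_mul_sum_norm_sq_le_sum_inner_pinnedLaplacian {E : Type*}
    [SeminormedAddCommGroup E] [InnerProductSpace ℝ E] (hN : 2 ≤ N)
    (hA : A.toSimpleGraph.Connected) :
    ∃ m : ℝ, 0 < m ∧ ∀ (j : Fin N) (z : Fin N → E),
      m * ∑ i, ‖z i‖ ^ 2 ≤ ∑ i, ⟪z i, A.pinnedLaplacian j z i⟫_ℝ := by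
  have hposDef : ∀ j, (screenedLaplacian (fun i => A.a i j) A.a).PosDef := fun j =>
    A.posDef_screenedLaplacian hA (fun i => A.nonneg i j) (A.exists_adj hN hA j)
  choose m hm hle using fun j => exists_pos_mul_dotProduct_le_of_posDef (hposDef j)
  have : Nonempty (Fin N) := ⟨⟨0, by omega⟩⟩
  obtain ⟨k, hk⟩ := Finite.exists_min m
  refine ⟨m k, hm k, fun j z => ?_⟩
  calc m k * ∑ i, ‖z i‖ ^ 2 ≤ m j * ∑ i, ‖z i‖ ^ 2 := by gcongr; exact hk j
    _ ≤ ∑ i, ⟪‖z i‖, A.a i j • ‖z i‖ + ∑ k, A.a i k • (‖z i‖ - ‖z k‖)⟫_ℝ := by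
        simpa [dotProduct, screenedLaplacian_mulVec_apply, mul_comm, sq] using
          hle j fun i => ‖z i‖
    _ ≤ ∑ i, ⟪z i, A.pinnedLaplacian j z i⟫_ℝ := by
        simp only [pinnedLaplacian, add_comm (∑ _, _)]
        rw [sum_inner_smul_add_sum_smul_sub A.symm, sum_inner_smul_add_sum_smul_sub A.symm]
        simp only [norm_norm]
        gcongr with i _ k
        · exact A.nonneg i k
        · exact abs_norm_sub_norm_le (z i) (z k)

end CommGraph

section Game

variable {ι E : Type*} [DecidableEq ι]

/-- `x` is a Nash equilibrium of the game with cost functions `f i`: no player lowers its own cost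
by a unilateral deviation. -/
def IsNashEquilibrium (f : ι → (ι → E) → ℝ) (x : ι → E) : Prop :=
  ∀ (i : ι) (v : E), f i x ≤ f i (Function.update x i v)

/-- The profile of the partial gradients of each player's cost in that player's own action. -/
noncomputable def pseudoGradient [NormedAddCommGroup E] [InnerProductSpace ℝ E] [CompleteSpace E]
    (f : ι → (ι → E) → ℝ) (x : ι → E) (i : ι) : E :=
  gradient (fun v => f i (Function.update x i v)) (x i)

end Game

section QuadraticExpansion

variable {E : Type*} [NormedAddCommGroup E] [InnerProductSpace ℝ E] [CompleteSpace E]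
  {f : E → ℝ} {a g : E} {Q : E →L[ℝ] E}

theorem hasGradientAt_of_quadratic_expansion
    (hf : ∀ h, f (a + h) = f a + ⟪g, h⟫_ℝ + ⟪h, Q h⟫_ℝ) : HasGradientAt f g a := by
  rw [hasGradientAt_iff_isLittleO_nhds_zero]
  have hremainder : ∀ h, f (a + h) - f a - ⟪g, h⟫_ℝ = ⟪h, Q h⟫_ℝ := fun h => by rw [hf]; ring
  simp only [hremainder]
  have hbound : (fun h => ⟪h, Q h⟫_ℝ) =O[𝓝 0] fun h => ‖h‖ ^ 2 :=
    Asymptotics.isBigO_of_le' (c := ‖Q‖) _ fun h => by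
      rw [norm_pow, norm_norm]
      calc ‖⟪h, Q h⟫_ℝ‖ ≤ ‖h‖ * ‖Q h‖ := norm_inner_le_norm h (Q h)
        _ ≤ ‖h‖ * (‖Q‖ * ‖h‖) := by gcongr; exact Q.le_opNorm h
        _ = ‖Q‖ * ‖h‖ ^ 2 := by ring
  exact hbound.trans_isLittleO (Asymptotics.isLittleO_norm_pow_id one_lt_two)

theorem forall_le_iff_of_quadratic_expansion (hQ : ∀ h, 0 ≤ ⟪h, Q h⟫_ℝ)
    (hf : ∀ h, f (a + h) = f a + ⟪g, h⟫_ℝ + ⟪h, Q h⟫_ℝ) : (∀ v, f a ≤ f v) ↔ g = 0 := by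
  constructor
  · intro hmin
    have hderiv := (hasGradientAt_of_quadratic_expansion hf).hasFDerivAt
    have hlocal : IsLocalMin f a := Eventually.of_forall hmin
    simpa using hlocal.hasFDerivAt_eq_zero hderiv
  · rintro rfl v
    have hv := hf (v - a)
    rw [add_sub_cancel, inner_zero_left, add_zero] at hv
    exact hv ▸ le_add_of_nonneg_right (hQ (v - a))

end QuadraticExpansion

section WeightedMonotone

variable {ι E : Type*} [Fintype ι] [NormedAddCommGroup E] [InnerProductSpace ℝ E]

/-- `F` is strongly monotone, with constant one, once the component of player `i` is weighted by
`w i`; for a pseudo-gradient this is Rosen's diagonal strict convexity. -/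
def WeightedStronglyMonotone (w : ι → ℝ) (F : (ι → E) → ι → E) : Prop :=
  ∀ x y, ∑ i, ‖x i - y i‖ ^ 2 ≤ ∑ i, w i * ⟪x i - y i, F x i - F y i⟫_ℝ

theorem surjective_of_mul_norm_sq_le_inner {H : Type*} [NormedAddCommGroup H]
    [InnerProductSpace ℝ H] [CompleteSpace H] {T : H →L[ℝ] H} {m : ℝ} (hm : 0 < m)
    (hT : ∀ u, m * ‖u‖ ^ 2 ≤ ⟪T u, u⟫_ℝ) : Function.Surjective T := by
  have hB : IsCoercive (innerSL ℝ ∘L T) := ⟨m, hm, fun u => by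
    rw [mul_assoc, ← sq]
    exact hT u⟩
  intro b
  refine ⟨hB.continuousLinearEquivOfBilin.symm b, ext_inner_right ℝ fun v => ?_⟩
  have := hB.continuousLinearEquivOfBilin_apply (hB.continuousLinearEquivOfBilin.symm b) v
  rw [ContinuousLinearEquiv.apply_symm_apply] at this
  exact this.symm

theorem WeightedStronglyMonotone.bijective [CompleteSpace E] {w : ι → ℝ} (hw : ∀ i, 0 < w i)
    {T : (ι → E) →L[ℝ] ι → E} (hT : WeightedStronglyMonotone w T) : Function.Bijective T := by
  constructor
  · intro x y hxy
    have hle := hT x y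
    simp only [hxy, sub_self, inner_zero_right, mul_zero, sum_const_zero] at hle
    have hzero := (sum_eq_zero_iff_of_nonneg fun i _ => sq_nonneg ‖x i - y i‖).1
      (hle.antisymm (sum_nonneg fun i _ => sq_nonneg _))
    exact funext fun i => by simpa [sub_eq_zero] using hzero i (mem_univ i)
  · let e := PiLp.continuousLinearEquiv 2 ℝ fun _ : ι => E
    let D : (ι → E) →L[ℝ] ι → E := .pi fun i => w i • .proj i
    have hsurj : Function.Surjective
        (e.symm.toContinuousLinearMap ∘L D ∘L T ∘L e.toContinuousLinearMap) := by
      refine surjective_of_mul_norm_sq_le_inner one_pos fun u => ?_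
      simpa [e, D, PiLp.norm_sq_eq_of_L2, PiLp.inner_apply, real_inner_smul_left,
        real_inner_smul_right, real_inner_comm (u _)] using hT (e u) 0
    intro b
    obtain ⟨u, hu⟩ := hsurj (e.symm (D b))
    refine ⟨e u, funext fun i => ?_⟩
    have hi := congrFun (e.symm.injective hu) i
    exact smul_right_injective E (hw i).ne' hi

end WeightedMonotone

/-- A game with strictly convex quadratic individual costs `⟪xᵢ, Rᵢ xᵢ⟫ + ⟪xᵢ, rᵢ⟫ + bᵢ` and
attractive couplings `cᵢⱼ ‖xᵢ - xⱼ‖²`, which need not be symmetric in `i` and `j`. A player ignores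
the opponents `j` with `cᵢⱼ = 0`. -/
structure QuadraticGame (ι E : Type*) [NormedAddCommGroup E] [InnerProductSpace ℝ E] where
  quad : ι → E →L[ℝ] E
  lin : ι → E
  const : ι → ℝ
  c : ι → ι → ℝ
  quad_isSymmetric : ∀ i, (quad i : E →ₗ[ℝ] E).IsSymmetric
  quad_coercive : ∀ i, ∃ m : ℝ, 0 < m ∧ ∀ v, m * ‖v‖ ^ 2 ≤ ⟪v, quad i v⟫_ℝ
  c_nonneg : ∀ i j, 0 ≤ c i j

namespace QuadraticGame

variable {ι E : Type*} [Fintype ι] [NormedAddCommGroup E] [InnerProductSpace ℝ E]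
  (Γ : QuadraticGame ι E)

/-- The cost of player `i`. -/
noncomputable def cost (i : ι) (x : ι → E) : ℝ :=
  ⟪x i, Γ.quad i (x i)⟫_ℝ + ⟪x i, Γ.lin i⟫_ℝ + Γ.const i + ∑ j, Γ.c i j * ‖x i - x j‖ ^ 2

/-- The linear part of the pseudo-gradient. -/
noncomputable def hess : (ι → E) →L[ℝ] ι → E :=
  .pi fun i => (2 : ℝ) • (Γ.quad i ∘L .proj i + ∑ j, Γ.c i j • (.proj i - .proj j))

theorem hess_apply (z : ι → E) (i : ι) :
    Γ.hess z i = (2 : ℝ) • (Γ.quad i (z i) + ∑ j, Γ.c i j • (z i - z j)) := by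
  simp [hess]

theorem screenedLaplacian_mulVec_norm_sq_le [DecidableEq ι] {m : ι → ℝ}
    (hm : ∀ i v, m i * ‖v‖ ^ 2 ≤ ⟪v, Γ.quad i v⟫_ℝ) (z : ι → E) (i : ι) :
    (screenedLaplacian (2 • m) Γ.c *ᵥ fun j => ‖z j‖ ^ 2) i ≤ ⟪z i, Γ.hess z i⟫_ℝ := by
  have hpair : ∀ j, ‖z i‖ ^ 2 - ‖z j‖ ^ 2 ≤ 2 * ⟪z i, z i - z j⟫_ℝ := fun j => by
    rw [inner_sub_right, real_inner_self_eq_norm_sq]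
    linarith [norm_sub_sq_real (z i) (z j), sq_nonneg ‖z i - z j‖]
  calc (screenedLaplacian (2 • m) Γ.c *ᵥ fun j => ‖z j‖ ^ 2) i
      = 2 * (m i * ‖z i‖ ^ 2) + ∑ j, Γ.c i j * (‖z i‖ ^ 2 - ‖z j‖ ^ 2) := by
        simp [screenedLaplacian_mulVec_apply, mul_assoc]
    _ ≤ 2 * ⟪z i, Γ.quad i (z i)⟫_ℝ + ∑ j, Γ.c i j * (2 * ⟪z i, z i - z j⟫_ℝ) := by
        gcongr with j
        · exact hm i (z i)
        · exact Γ.c_nonneg i j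
        · exact hpair j
    _ = ⟪z i, Γ.hess z i⟫_ℝ := by
        simp only [hess_apply, real_inner_smul_right, inner_add_right, inner_sum, mul_add, mul_sum,
          mul_left_comm]

theorem exists_weightedStronglyMonotone_hess :
    ∃ w : ι → ℝ, (∀ i, 0 < w i) ∧ WeightedStronglyMonotone w Γ.hess := by
  classical
  choose m hm hcoercive using Γ.quad_coercive
  obtain ⟨w, hw, hwL⟩ := exists_pos_vecMul_screenedLaplacian_eq_one
    (l := 2 • m) (fun i => nsmul_pos (hm i) two_ne_zero) Γ.c_nonneg
  refine ⟨w, hw, fun x y => ?_⟩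
  calc ∑ i, ‖x i - y i‖ ^ 2
      = w ⬝ᵥ screenedLaplacian (2 • m) Γ.c *ᵥ fun j => ‖x j - y j‖ ^ 2 := by
        rw [Matrix.dotProduct_mulVec, hwL, one_dotProduct]
    _ ≤ w ⬝ᵥ fun i => ⟪x i - y i, Γ.hess (x - y) i⟫_ℝ := sum_le_sum fun i _ =>
        mul_le_mul_of_nonneg_left (Γ.screenedLaplacian_mulVec_norm_sq_le hcoercive (x - y) i)
          (hw i).le
    _ = ∑ i, w i * ⟪x i - y i, Γ.hess x i - Γ.hess y i⟫_ℝ := by rw [map_sub]; rfl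

variable [DecidableEq ι]

/-- The Hessian of the cost of player `i` in its own action, up to the factor `2`. -/
noncomputable def ownQuad (i : ι) : E →L[ℝ] E :=
  Γ.quad i + (∑ j ∈ univ.erase i, Γ.c i j) • .id ℝ E

theorem inner_ownQuad_nonneg (i : ι) (h : E) : 0 ≤ ⟪h, Γ.ownQuad i h⟫_ℝ := by
  obtain ⟨m, hm, hle⟩ := Γ.quad_coercive i
  have hquad : 0 ≤ ⟪h, Γ.quad i h⟫_ℝ := le_trans (by positivity) (hle h)
  have hsum : 0 ≤ ∑ j ∈ univ.erase i, Γ.c i j := sum_nonneg fun j _ => Γ.c_nonneg i j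
  simpa [ownQuad, inner_add_right, real_inner_smul_right] using
    add_nonneg hquad (mul_nonneg hsum (sq_nonneg ‖h‖))

theorem cost_update_add (i : ι) (x : ι → E) (h : E) :
    Γ.cost i (Function.update x i (x i + h)) =
      Γ.cost i x + ⟪Γ.hess x i + Γ.lin i, h⟫_ℝ + ⟪h, Γ.ownQuad i h⟫_ℝ := by
  have hquad : ⟪x i + h, Γ.quad i (x i + h)⟫_ℝ =
      ⟪x i, Γ.quad i (x i)⟫_ℝ + 2 * ⟪Γ.quad i (x i), h⟫_ℝ + ⟪h, Γ.quad i h⟫_ℝ := by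
    have hsymm : ⟪x i, Γ.quad i h⟫_ℝ = ⟪Γ.quad i (x i), h⟫_ℝ :=
      (Γ.quad_isSymmetric i (x i) h).symm
    rw [map_add, inner_add_left, inner_add_right, inner_add_right, hsymm,
      real_inner_comm (Γ.quad i (x i)) h]
    ring
  have hpair : ∀ j ∈ univ.erase i, Γ.c i j * ‖x i + h - Function.update x i (x i + h) j‖ ^ 2 =
      Γ.c i j * ‖x i - x j‖ ^ 2 + 2 * (Γ.c i j * ⟪x i - x j, h⟫_ℝ) + Γ.c i j * ‖h‖ ^ 2 :=
    fun j hj => by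
      rw [Function.update_of_ne (ne_of_mem_erase hj), add_sub_right_comm, norm_add_sq_real]
      ring
  have herase : ∀ g : ι → ℝ, g i = 0 → ∑ j, g j = ∑ j ∈ univ.erase i, g j := fun g hg =>
    (sum_erase univ hg).symm
  simp only [cost, hess_apply, ownQuad, Function.update_self, hquad, inner_add_left,
    real_inner_smul_left, sum_inner, add_apply, smul_apply, ContinuousLinearMap.id_apply,
    inner_add_right, real_inner_smul_right, real_inner_self_eq_norm_sq,
    real_inner_comm h (Γ.lin i)]
  rw [herase _ (by simp), herase (fun j => Γ.c i j * ‖x i - x j‖ ^ 2) (by simp),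
    herase (fun j => Γ.c i j * ⟪x i - x j, h⟫_ℝ) (by simp), sum_congr rfl hpair]
  simp only [sum_add_distrib, ← mul_sum, ← sum_mul]
  ring

variable [CompleteSpace E]

theorem pseudoGradient_cost (x : ι → E) : pseudoGradient Γ.cost x = Γ.hess x + Γ.lin :=
  funext fun i => (hasGradientAt_of_quadratic_expansion (Q := Γ.ownQuad i) fun h => by
    rw [Γ.cost_update_add, Function.update_eq_self]; rfl).gradient

theorem isNashEquilibrium_iff (x : ι → E) :
    IsNashEquilibrium Γ.cost x ↔ pseudoGradient Γ.cost x = 0 := by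
  rw [pseudoGradient_cost, funext_iff]
  refine forall_congr' fun i => ?_
  have hiff := forall_le_iff_of_quadratic_expansion
    (f := fun v => Γ.cost i (Function.update x i v)) (a := x i) (g := Γ.hess x i + Γ.lin i)
    (Γ.inner_ownQuad_nonneg i) fun h => by rw [Γ.cost_update_add, Function.update_eq_self]
  rwa [Function.update_eq_self] at hiff

theorem lipschitzWith_pseudoGradient : LipschitzWith ‖Γ.hess‖₊ (pseudoGradient Γ.cost) := by
  simpa [funext Γ.pseudoGradient_cost] using Γ.hess.lipschitz.add (LipschitzWith.const Γ.lin)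

theorem existsUnique_isNashEquilibrium : ∃! x, IsNashEquilibrium Γ.cost x := by
  obtain ⟨w, hw, hmono⟩ := Γ.exists_weightedStronglyMonotone_hess
  simp only [isNashEquilibrium_iff, pseudoGradient_cost, add_eq_zero_iff_eq_neg]
  exact (hmono.bijective hw).existsUnique (-Γ.lin)

theorem exists_weightedStronglyMonotone_pseudoGradient :
    ∃ w : ι → ℝ, (∀ i, 0 < w i) ∧ WeightedStronglyMonotone w (pseudoGradient Γ.cost) := by
  obtain ⟨w, hw, hmono⟩ := Γ.exists_weightedStronglyMonotone_hess
  refine ⟨w, hw, fun x y => ?_⟩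
  simpa [pseudoGradient_cost] using hmono x y

end QuadraticGame

section ObserverForm

variable {E : Type*} [NormedAddCommGroup E] [InnerProductSpace ℝ E] {k₁ k₂ : ℝ}

/-- The weight of `‖p‖²` in `observerForm`. -/
noncomputable def obsP (k₁ k₂ : ℝ) : ℝ := (k₂ + 1) / k₁

/-- The weight of `‖q‖²` in `observerForm`. -/
noncomputable def obsQ (k₁ k₂ : ℝ) : ℝ := (obsP k₁ k₂ + k₁) / k₂

/-- A quadratic Lyapunov function of the observer error dynamics `ṗ = q - k₁ p`, `q̇ = -k₂ p`. Its
weights solve the Lyapunov equation that makes its derivative `-2 (‖p‖² + ‖q‖²)`. -/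
noncomputable def observerForm (k₁ k₂ : ℝ) (p q : E) : ℝ :=
  obsP k₁ k₂ * ‖p‖ ^ 2 - 2 * ⟪p, q⟫_ℝ + obsQ k₁ k₂ * ‖q‖ ^ 2

/-- The derivative of `observerForm` at `(p, q)` in the direction `(p', q')`. -/
noncomputable def observerFormDeriv (k₁ k₂ : ℝ) (p q p' q' : E) : ℝ :=
  obsP k₁ k₂ * (2 * ⟪p, p'⟫_ℝ) - 2 * (⟪p, q'⟫_ℝ + ⟪p', q⟫_ℝ) + obsQ k₁ k₂ * (2 * ⟪q, q'⟫_ℝ)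

theorem obsP_pos (hk₁ : 0 < k₁) (hk₂ : 0 < k₂) : 0 < obsP k₁ k₂ := by
  unfold obsP
  positivity

theorem obsQ_pos (hk₁ : 0 < k₁) (hk₂ : 0 < k₂) : 0 < obsQ k₁ k₂ :=
  div_pos (add_pos (obsP_pos hk₁ hk₂) hk₁) hk₂

theorem one_lt_obsP_mul_obsQ (hk₁ : 0 < k₁) (hk₂ : 0 < k₂) : 1 < obsP k₁ k₂ * obsQ k₁ k₂ := by
  have ha : obsP k₁ k₂ * k₁ = k₂ + 1 := div_mul_cancel₀ _ hk₁.ne'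
  rw [obsQ, ← mul_div_assoc, one_lt_div hk₂]
  nlinarith [sq_nonneg (obsP k₁ k₂)]

theorem observerForm_le (hk₁ : 0 < k₁) (hk₂ : 0 < k₂) (p q : E) :
    observerForm k₁ k₂ p q ≤ (obsP k₁ k₂ + obsQ k₁ k₂ + 1) * (‖p‖ ^ 2 + ‖q‖ ^ 2) := by
  have hcross : -(2 * ⟪p, q⟫_ℝ) ≤ ‖p‖ ^ 2 + ‖q‖ ^ 2 := by
    linarith [norm_add_sq_real p q, sq_nonneg ‖p + q‖]
  have hp := mul_nonneg (obsQ_pos hk₁ hk₂).le (sq_nonneg ‖p‖)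
  have hq := mul_nonneg (obsP_pos hk₁ hk₂).le (sq_nonneg ‖q‖)
  unfold observerForm
  linarith

-- Determinant over trace bounds the smallest eigenvalue of the form from below.
theorem le_observerForm (hk₁ : 0 < k₁) (hk₂ : 0 < k₂) (p q : E) :
    (obsP k₁ k₂ * obsQ k₁ k₂ - 1) / (obsP k₁ k₂ + obsQ k₁ k₂) * (‖p‖ ^ 2 + ‖q‖ ^ 2) ≤
      observerForm k₁ k₂ p q := by
  have ha := obsP_pos hk₁ hk₂
  have hc := obsQ_pos hk₁ hk₂
  rw [observerForm]
  set a := obsP k₁ k₂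
  set c := obsQ k₁ k₂
  set m := (a * c - 1) / (a + c) with hm
  have hm_mul : m * (a + c) = a * c - 1 := div_mul_cancel₀ _ (add_pos ha hc).ne'
  have hma : 0 < a - m := by
    rw [hm, sub_pos, div_lt_iff₀ (add_pos ha hc)]
    nlinarith
  have hmc : 1 / (a - m) ≤ c - m := by
    rw [div_le_iff₀ hma]
    nlinarith [sq_nonneg m]
  have hyoung := two_mul_inner_le_mul_sq_add_sq_div p q hma
  have hq : ‖q‖ ^ 2 / (a - m) ≤ (c - m) * ‖q‖ ^ 2 := by
    rw [div_eq_mul_one_div, mul_comm]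
    gcongr
  linarith

theorem observerFormDeriv_le (hk₁ : 0 < k₁) (hk₂ : 0 < k₂) (p q δ : E) {σ : ℝ} (hσ : 0 < σ) :
    observerFormDeriv k₁ k₂ p q (σ • (q - k₁ • p)) (δ - (σ * k₂) • p) ≤
      -σ * (‖p‖ ^ 2 + ‖q‖ ^ 2) + (1 + obsQ k₁ k₂ ^ 2) * ‖δ‖ ^ 2 / σ := by
  have ha : obsP k₁ k₂ * k₁ = k₂ + 1 := div_mul_cancel₀ _ hk₁.ne'
  have hc : obsQ k₁ k₂ * k₂ = obsP k₁ k₂ + k₁ := div_mul_cancel₀ _ hk₂.ne'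
  have hlyap : observerFormDeriv k₁ k₂ p q (σ • (q - k₁ • p)) (δ - (σ * k₂) • p) =
      -2 * σ * (‖p‖ ^ 2 + ‖q‖ ^ 2) + 2 * ⟪-p, δ⟫_ℝ + 2 * ⟪q, obsQ k₁ k₂ • δ⟫_ℝ := by
    simp only [observerFormDeriv, inner_sub_left, inner_sub_right, inner_neg_left,
      real_inner_smul_left, real_inner_smul_right, real_inner_self_eq_norm_sq, real_inner_comm p q]
    linear_combination (-2 * σ * ‖p‖ ^ 2) * ha - 2 * σ * ⟪p, q⟫_ℝ * hc
  have hp := two_mul_inner_le_mul_sq_add_sq_div (-p) δ hσ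
  have hq := two_mul_inner_le_mul_sq_add_sq_div q (obsQ k₁ k₂ • δ) hσ
  rw [norm_smul, mul_pow, Real.norm_eq_abs, sq_abs] at hq
  rw [norm_neg] at hp
  rw [hlyap, add_mul, one_mul, add_div]
  linarith

theorem hasDerivWithinAt_observerForm {p q : ℝ → E} {p' q' : E} {s : Set ℝ} {t : ℝ}
    (hp : HasDerivWithinAt p p' s t) (hq : HasDerivWithinAt q q' s t) :
    HasDerivWithinAt (fun τ => observerForm k₁ k₂ (p τ) (q τ))
      (observerFormDeriv k₁ k₂ (p t) (q t) p' q') s t :=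
  ((hp.norm_sq.const_mul _).sub ((hp.inner ℝ hq).const_mul 2)).add (hq.norm_sq.const_mul _)

end ObserverForm

section ProductNorm

variable {ι E : Type*} [Fintype ι] [SeminormedAddCommGroup E]

theorem norm_sq_le_sum_norm_sq (z : ι → E) : ‖z‖ ^ 2 ≤ ∑ i, ‖z i‖ ^ 2 := by
  rw [← Real.le_sqrt (norm_nonneg z) (sum_nonneg fun i _ => sq_nonneg _)]
  refine (pi_norm_le_iff_of_nonneg (Real.sqrt_nonneg _)).2 fun i => Real.le_sqrt_of_sq_le ?_
  exact single_le_sum (f := fun i => ‖z i‖ ^ 2) (fun j _ => sq_nonneg ‖z j‖) (mem_univ i)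

theorem norm_apply_sub_apply_sq_le {L : ℝ≥0} {F : (ι → E) → ι → E}
    (hF : LipschitzWith L F) (x y : ι → E) (i : ι) :
    ‖F x i - F y i‖ ^ 2 ≤ L ^ 2 * ∑ j, ‖x j - y j‖ ^ 2 :=
  calc ‖F x i - F y i‖ ^ 2 ≤ (L * ‖x - y‖) ^ 2 := by
        gcongr
        exact (norm_le_pi_norm (F x - F y) i).trans (hF.norm_sub_le x y)
    _ ≤ L ^ 2 * ∑ j, ‖x j - y j‖ ^ 2 := by
        rw [mul_pow]
        gcongr
        exact norm_sq_le_sum_norm_sq (x - y)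

end ProductNorm

section ClosedLoop

variable {N : ℕ} {E : Type*}

/-- The state of the closed loop: positions `xᵢ`, observer states `x̂ᵢ`, `ẑᵢ` and the estimates
`yᵢⱼ` by player `i` of the position of player `j`. -/
structure SeekingState (N : ℕ) (E : Type*) where
  x : Fin N → E
  xhat : Fin N → E
  zhat : Fin N → E
  y : Fin N → Fin N → E

/-- The errors of the closed loop, or a tangent vector to them: `ξᵢ = xᵢ - xᵢ*`, `ηᵢⱼ = yᵢⱼ - xⱼ`,
`pᵢ = σ (xᵢ - x̂ᵢ)` and `qᵢ = dᵢ - ẑᵢ`. -/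
structure LoopError (N : ℕ) (E : Type*) where
  ξ : Fin N → E
  η : Fin N → Fin N → E
  p : Fin N → E
  q : Fin N → E

/-- The error of a state from the profile `xs` under the disturbance values `d`. The observer error
`x - x̂` is multiplied by `s`, which is the gain `σ` in the Lyapunov analysis and `1` in the final
estimate. -/
def SeekingState.error [AddCommGroup E] [Module ℝ E] (S : SeekingState N E) (s : ℝ)
    (xs d : Fin N → E) : LoopError N E where
  ξ i := S.x i - xs i
  η i j := S.y i j - S.x j
  p i := s • (S.x i - S.xhat i)
  q i := d i - S.zhat i

namespace LoopError

variable [NormedAddCommGroup E] {F : (Fin N → E) → Fin N → E} {xs : Fin N → E} {L : ℝ≥0}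

/-- The squared Euclidean norm of the concatenated error. -/
def normSq (e : LoopError N E) : ℝ :=
  ∑ i, ‖e.ξ i‖ ^ 2 + ∑ i, ∑ j, ‖e.η i j‖ ^ 2 + ∑ i, (‖e.p i‖ ^ 2 + ‖e.q i‖ ^ 2)

/-- The velocity of player `i` in the closed loop, in terms of the errors. -/
def velocity (F : (Fin N → E) → Fin N → E) (xs : Fin N → E) (e : LoopError N E) (i : Fin N) : E :=
  e.q i - F (fun j => xs j + e.ξ j + e.η i j) i

theorem sum_norm_velocity_sq_le (hF : LipschitzWith L F) (hxs : F xs = 0) (e : LoopError N E) :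
    ∑ i, ‖e.velocity F xs i‖ ^ 2 ≤ 4 * L ^ 2 * (N * ∑ i, ‖e.ξ i‖ ^ 2 + ∑ i, ∑ j, ‖e.η i j‖ ^ 2) +
      2 * ∑ i, ‖e.q i‖ ^ 2 := by
  have hadd : ∀ u v : E, ‖u + v‖ ^ 2 ≤ 2 * (‖u‖ ^ 2 + ‖v‖ ^ 2) := fun u v =>
    (pow_le_pow_left₀ (norm_nonneg _) (norm_add_le u v) 2).trans add_sq_le
  have hplayer : ∀ i, ‖e.velocity F xs i‖ ^ 2 ≤
      4 * L ^ 2 * (∑ j, ‖e.ξ j‖ ^ 2 + ∑ j, ‖e.η i j‖ ^ 2) + 2 * ‖e.q i‖ ^ 2 := by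
    intro i
    have hforce := norm_apply_sub_apply_sq_le hF (fun j => xs j + e.ξ j + e.η i j) xs i
    simp only [hxs, Pi.zero_apply, sub_zero, add_assoc, add_sub_cancel_left] at hforce
    have hsum : ∑ j, ‖e.ξ j + e.η i j‖ ^ 2 ≤ 2 * (∑ j, ‖e.ξ j‖ ^ 2 + ∑ j, ‖e.η i j‖ ^ 2) := by
      rw [← sum_add_distrib, mul_sum]
      exact sum_le_sum fun j _ => hadd _ _
    have hvel := hadd (e.q i) (-F (fun j => xs j + (e.ξ j + e.η i j)) i)
    rw [norm_neg, ← sub_eq_add_neg] at hvel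
    simp only [velocity, add_assoc]
    linarith [mul_le_mul_of_nonneg_left hsum (sq_nonneg (L : ℝ))]
  refine (sum_le_sum fun i _ => hplayer i).trans_eq ?_
  simp only [sum_add_distrib, ← mul_sum, sum_const, card_univ, Fintype.card_fin, nsmul_eq_mul]

variable [InnerProductSpace ℝ E]

/-- The vector field of the closed loop in the error coordinates with observer scaling `s = σ`,
where `d'` is the velocity of the disturbance. -/
def vectorField (F : (Fin N → E) → Fin N → E) (xs : Fin N → E) (A : CommGraph N) (K : FixedGains N)
    (θ σ : ℝ) (d' : Fin N → E) (e : LoopError N E) : LoopError N E where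
  ξ := e.velocity F xs
  η i j := -(θ * K.thetaBar i j) • A.pinnedLaplacian j (fun k => e.η k j) i - e.velocity F xs j
  p i := σ • (e.q i - K.k₁ i • e.p i)
  q i := d' i - (σ * K.k₂ i) • e.p i

/-- The Lyapunov function of the closed loop, with weights `w` of the players. -/
noncomputable def lyapunov (w : Fin N → ℝ) (K : FixedGains N) (e : LoopError N E) : ℝ :=
  ∑ i, w i * ‖e.ξ i‖ ^ 2 + ∑ i, ∑ j, (K.thetaBar i j)⁻¹ * ‖e.η i j‖ ^ 2 +
    ∑ i, observerForm (K.k₁ i) (K.k₂ i) (e.p i) (e.q i)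

/-- The derivative of `lyapunov` at `e` in the direction `e'`. -/
noncomputable def lyapunovDeriv (w : Fin N → ℝ) (K : FixedGains N) (e e' : LoopError N E) : ℝ :=
  ∑ i, w i * (2 * ⟪e.ξ i, e'.ξ i⟫_ℝ) +
    ∑ i, ∑ j, (K.thetaBar i j)⁻¹ * (2 * ⟪e.η i j, e'.η i j⟫_ℝ) +
    ∑ i, observerFormDeriv (K.k₁ i) (K.k₂ i) (e.p i) (e.q i) (e'.p i) (e'.q i)

variable {w : Fin N → ℝ} {K : FixedGains N}

theorem hasDerivWithinAt_lyapunov {e : ℝ → LoopError N E} {e' : LoopError N E} {s : Set ℝ} {t : ℝ}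
    (hξ : ∀ i, HasDerivWithinAt (fun τ => (e τ).ξ i) (e'.ξ i) s t)
    (hη : ∀ i j, HasDerivWithinAt (fun τ => (e τ).η i j) (e'.η i j) s t)
    (hp : ∀ i, HasDerivWithinAt (fun τ => (e τ).p i) (e'.p i) s t)
    (hq : ∀ i, HasDerivWithinAt (fun τ => (e τ).q i) (e'.q i) s t) :
    HasDerivWithinAt (fun τ => (e τ).lyapunov w K) ((e t).lyapunovDeriv w K e') s t :=
  ((HasDerivWithinAt.fun_sum fun i _ => (hξ i).norm_sq.const_mul _).add
    (HasDerivWithinAt.fun_sum fun i _ => HasDerivWithinAt.fun_sum fun j _ =>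
      (hη i j).norm_sq.const_mul _)).add
    (HasDerivWithinAt.fun_sum fun i _ => hasDerivWithinAt_observerForm (hp i) (hq i))

variable (K) in
theorem exists_lyapunov_le (w : Fin N → ℝ) :
    ∃ B : ℝ, 0 < B ∧ ∀ e : LoopError N E, e.lyapunov w K ≤ B * e.normSq := by
  obtain ⟨W, hW⟩ := Finite.exists_le w
  obtain ⟨b, hb⟩ := Finite.exists_le fun ij : Fin N × Fin N => (K.thetaBar ij.1 ij.2)⁻¹
  obtain ⟨C, hC⟩ := Finite.exists_le fun i => obsP (K.k₁ i) (K.k₂ i) + obsQ (K.k₁ i) (K.k₂ i) + 1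
  refine ⟨max 1 (max W (max b C)), by positivity, fun e => ?_⟩
  simp only [lyapunov, normSq, mul_add, mul_sum]
  gcongr with i _ i _ j _ i _
  · exact (hW i).trans (by simp)
  · exact (hb (i, j)).trans (by simp)
  · rw [← mul_add]
    refine (observerForm_le (K.k₁_pos i) (K.k₂_pos i) _ _).trans ?_
    gcongr
    exact (hC i).trans (by simp)

variable (K) in
theorem exists_normSq_le_mul_lyapunov (hw : ∀ i, 0 < w i) :
    ∃ C : ℝ, 0 < C ∧ ∀ e : LoopError N E, e.normSq ≤ C * e.lyapunov w K := by
  let μ (i : Fin N) : ℝ := (obsP (K.k₁ i) (K.k₂ i) * obsQ (K.k₁ i) (K.k₂ i) - 1) /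
    (obsP (K.k₁ i) (K.k₂ i) + obsQ (K.k₁ i) (K.k₂ i))
  have hμ : ∀ i, 0 < μ i := fun i =>
    div_pos (sub_pos.2 (one_lt_obsP_mul_obsQ (K.k₁_pos i) (K.k₂_pos i)))
      (add_pos (obsP_pos (K.k₁_pos i) (K.k₂_pos i)) (obsQ_pos (K.k₁_pos i) (K.k₂_pos i)))
  obtain ⟨W, hW⟩ := Finite.exists_le fun i => (w i)⁻¹
  obtain ⟨b, hb⟩ := Finite.exists_le fun ij : Fin N × Fin N => K.thetaBar ij.1 ij.2
  obtain ⟨D, hD⟩ := Finite.exists_le fun i => (μ i)⁻¹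
  have hmul : ∀ {r u v C : ℝ}, 0 < r → r⁻¹ ≤ C → 0 ≤ u → r * u ≤ v → u ≤ C * v :=
    fun {r u v C} hr hrC hu huv =>
      calc u = r⁻¹ * (r * u) := by rw [inv_mul_cancel_left₀ hr.ne']
        _ ≤ C * v := mul_le_mul hrC huv (by positivity) ((inv_pos.2 hr).le.trans hrC)
  refine ⟨max 1 (max W (max b D)), by positivity, fun e => ?_⟩
  simp only [lyapunov, normSq, mul_add, mul_sum]
  gcongr with i _ i _ j _ i _
  · exact hmul (hw i) ((hW i).trans (by simp)) (sq_nonneg _) le_rfl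
  · refine hmul (inv_pos.2 (K.thetaBar_pos i j)) ?_ (sq_nonneg _) le_rfl
    rw [inv_inv]
    exact (hb (i, j)).trans (by simp)
  · exact hmul (hμ i) ((hD i).trans (by simp)) (by positivity)
      (le_observerForm (K.k₁_pos i) (K.k₂_pos i) _ _)

theorem sum_mul_inner_velocity_le {W : ℝ} (hF : LipschitzWith L F)
    (hmono : WeightedStronglyMonotone w F) (hxs : F xs = 0) (hw : ∀ i, 0 < w i) (hW : ∀ i, w i ≤ W)
    (e : LoopError N E) :
    ∑ i, w i * (2 * ⟪e.ξ i, e.velocity F xs i⟫_ℝ) ≤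
      -(3 / 2) * ∑ i, ‖e.ξ i‖ ^ 2 +
        4 * W ^ 2 * (L ^ 2 * ∑ i, ∑ j, ‖e.η i j‖ ^ 2 + ∑ i, ‖e.q i‖ ^ 2) := by
  let x : Fin N → E := xs + e.ξ
  let y (i : Fin N) : Fin N → E := fun j => xs j + e.ξ j + e.η i j
  have hdrift : ∑ i, ‖e.ξ i‖ ^ 2 ≤ ∑ i, w i * ⟪e.ξ i, F x i⟫_ℝ := by
    simpa [x, hxs] using hmono x xs
  have hmismatch : ∀ i, ‖F x i - F (y i) i‖ ^ 2 ≤ L ^ 2 * ∑ j, ‖e.η i j‖ ^ 2 := fun i => by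
    simpa [x, y] using norm_apply_sub_apply_sq_le hF x (y i) i
  have hplayer : ∀ i, w i * (2 * ⟪e.ξ i, e.velocity F xs i⟫_ℝ) ≤ -(2 * (w i * ⟪e.ξ i, F x i⟫_ℝ)) +
      (1 / 2 * ‖e.ξ i‖ ^ 2 + 4 * W ^ 2 * (L ^ 2 * ∑ j, ‖e.η i j‖ ^ 2 + ‖e.q i‖ ^ 2)) := by
    intro i
    have hsplit : e.velocity F xs i = -F x i + (e.q i + (F x i - F (y i) i)) := by
      simp only [velocity, y]
      abel
    have hyoung := two_mul_inner_le_mul_sq_add_sq_div (e.ξ i)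
      (w i • (e.q i + (F x i - F (y i) i))) one_half_pos
    have hforce : ‖w i • (e.q i + (F x i - F (y i) i))‖ ^ 2 ≤
        W ^ 2 * (2 * (L ^ 2 * ∑ j, ‖e.η i j‖ ^ 2 + ‖e.q i‖ ^ 2)) := by
      rw [norm_smul, mul_pow, Real.norm_of_nonneg (hw i).le]
      have hwi := (hw i).le
      gcongr
      · exact hW i
      · calc _ ≤ (‖e.q i‖ + ‖F x i - F (y i) i‖) ^ 2 := by gcongr; exact norm_add_le _ _
          _ ≤ 2 * (‖e.q i‖ ^ 2 + ‖F x i - F (y i) i‖ ^ 2) := add_sq_le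
          _ ≤ _ := by linarith [hmismatch i]
    rw [hsplit, inner_add_right, inner_neg_right]
    rw [real_inner_smul_right] at hyoung
    linarith
  refine (sum_le_sum fun i _ => hplayer i).trans ?_
  simp only [sum_add_distrib, sum_neg_distrib, ← mul_sum]
  linarith

variable (K) in
theorem sum_mul_inner_estimation_le {A : CommGraph N} {m : ℝ}
    (hm : ∀ (j : Fin N) (z : Fin N → E),
      m * ∑ i, ‖z i‖ ^ 2 ≤ ∑ i, ⟪z i, A.pinnedLaplacian j z i⟫_ℝ)
    {b : ℝ} (hb : ∀ i j, (K.thetaBar i j)⁻¹ ≤ b) {θ s : ℝ} (hθ : 0 ≤ θ) (hs : 0 < s)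
    (η : Fin N → Fin N → E) (v : Fin N → E) :
    ∑ i, ∑ j, (K.thetaBar i j)⁻¹ * (2 * ⟪η i j,
        -(θ * K.thetaBar i j) • A.pinnedLaplacian j (fun k => η k j) i - v j⟫_ℝ) ≤
      (s * b ^ 2 - 2 * θ * m) * ∑ i, ∑ j, ‖η i j‖ ^ 2 + N / s * ∑ j, ‖v j‖ ^ 2 := by
  have hpair : ∀ i j, (K.thetaBar i j)⁻¹ * (2 * ⟪η i j,
        -(θ * K.thetaBar i j) • A.pinnedLaplacian j (fun k => η k j) i - v j⟫_ℝ) ≤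
      -(2 * θ) * ⟪η i j, A.pinnedLaplacian j (fun k => η k j) i⟫_ℝ +
        (s * b ^ 2 * ‖η i j‖ ^ 2 + ‖v j‖ ^ 2 / s) := by
    intro i j
    have hpos := inv_pos.2 (K.thetaBar_pos i j)
    have hyoung := two_mul_inner_le_mul_sq_add_sq_div (-(K.thetaBar i j)⁻¹ • η i j) (v j) hs
    have hscale : ‖-(K.thetaBar i j)⁻¹ • η i j‖ ^ 2 ≤ b ^ 2 * ‖η i j‖ ^ 2 := by
      rw [norm_smul, norm_neg, mul_pow, Real.norm_of_nonneg hpos.le]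
      gcongr
      exact hb i j
    have hcancel : (K.thetaBar i j)⁻¹ * (θ * K.thetaBar i j) = θ := by
      rw [mul_left_comm, inv_mul_cancel₀ (K.thetaBar_pos i j).ne', mul_one]
    rw [real_inner_smul_left] at hyoung
    rw [inner_sub_right, real_inner_smul_right]
    linear_combination hyoung + s * hscale -
      2 * ⟪η i j, A.pinnedLaplacian j (fun k => η k j) i⟫_ℝ * hcancel
  have hcoercive : m * ∑ i, ∑ j, ‖η i j‖ ^ 2 ≤
      ∑ i, ∑ j, ⟪η i j, A.pinnedLaplacian j (fun k => η k j) i⟫_ℝ := by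
    rw [sum_comm, mul_sum, sum_comm (s := univ)]
    exact sum_le_sum fun j _ => hm j fun i => η i j
  refine (sum_le_sum fun i _ => sum_le_sum fun j _ => hpair i j).trans ?_
  simp only [sum_add_distrib, ← mul_sum, ← sum_div, sum_const, card_univ, Fintype.card_fin,
    nsmul_eq_mul]
  linear_combination 2 * θ * hcoercive

theorem sum_observerFormDeriv_le {C : ℝ} (hC : ∀ i, 1 + obsQ (K.k₁ i) (K.k₂ i) ^ 2 ≤ C) {σ : ℝ}
    (hσ : 0 < σ) (p q δ : Fin N → E) :
    ∑ i, observerFormDeriv (K.k₁ i) (K.k₂ i) (p i) (q i) (σ • (q i - K.k₁ i • p i))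
        (δ i - (σ * K.k₂ i) • p i) ≤
      -σ * ∑ i, (‖p i‖ ^ 2 + ‖q i‖ ^ 2) + C * (∑ i, ‖δ i‖ ^ 2) / σ := by
  rw [mul_sum, mul_sum, sum_div, ← sum_add_distrib]
  refine sum_le_sum fun i _ =>
    (observerFormDeriv_le (K.k₁_pos i) (K.k₂_pos i) _ _ _ hσ).trans ?_
  gcongr
  exact hC i

variable (K) in
theorem exists_lyapunovDeriv_vectorField_le (hN : 2 ≤ N) {A : CommGraph N}
    (hA : A.toSimpleGraph.Connected) (hF : LipschitzWith L F) (hw : ∀ i, 0 < w i)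
    (hmono : WeightedStronglyMonotone w F) (hxs : F xs = 0) :
    ∃ θs σs C : ℝ, 0 < θs ∧ 1 ≤ σs ∧ 0 < C ∧ ∀ θ, θs < θ → ∀ σ, σs < σ →
      ∀ (d' : Fin N → E) (e : LoopError N E),
        e.lyapunovDeriv w K (e.vectorField F xs A K θ σ d') ≤
          -e.normSq + C * (∑ i, ‖d' i‖ ^ 2) / σ := by
  obtain ⟨m, hm, hpinned⟩ :=
    A.exists_pos_mul_sum_norm_sq_le_sum_inner_pinnedLaplacian (E := E) hN hA
  obtain ⟨W, hW⟩ := Finite.exists_le w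
  obtain ⟨b, hb⟩ := Finite.exists_le fun ij : Fin N × Fin N => (K.thetaBar ij.1 ij.2)⁻¹
  obtain ⟨C, hC⟩ := Finite.exists_le fun i => 1 + obsQ (K.k₁ i) (K.k₂ i) ^ 2
  -- so large that the position errors in the velocity term use up at most `1 / 2` of their decay
  let s : ℝ := 8 * N ^ 2 * L ^ 2 + 1
  have hs : 1 ≤ s := le_add_of_nonneg_left (by positivity)
  refine ⟨(1 + 4 * W ^ 2 * L ^ 2 + s * b ^ 2 + 4 * N * L ^ 2) / (2 * m), 1 + 4 * W ^ 2 + 2 * N,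
    max 1 C, by positivity, by linarith [sq_nonneg W, N.cast_nonneg (α := ℝ)], by positivity,
    fun θ hθ σ hσ d' e => ?_⟩
  have hσ0 : 0 < σ := by nlinarith [sq_nonneg W, N.cast_nonneg (α := ℝ)]
  have hθ0 : 0 < θ := lt_of_le_of_lt (by positivity) hθ
  have hvelocity := sum_norm_velocity_sq_le hF hxs e
  have hposition := sum_mul_inner_velocity_le hF hmono hxs hw hW e
  have hestimation := sum_mul_inner_estimation_le K hpinned (fun i j => hb (i, j)) hθ0.le
    (one_pos.trans_le hs) e.η (e.velocity F xs)
  have hobserver := sum_observerFormDeriv_le (K := K) (fun i => (hC i).trans (le_max_right 1 C))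
    hσ0 e.p e.q d'
  have hcoupling : N / s * ∑ i, ‖e.velocity F xs i‖ ^ 2 ≤ 1 / 2 * ∑ i, ‖e.ξ i‖ ^ 2 +
      (4 * N * L ^ 2 * ∑ i, ∑ j, ‖e.η i j‖ ^ 2 + 2 * N * ∑ i, ‖e.q i‖ ^ 2) := by
    rw [div_mul_eq_mul_div, div_le_iff₀ (one_pos.trans_le hs)]
    have hscale := mul_le_mul_of_nonneg_left hs
      (show 0 ≤ 4 * N * L ^ 2 * ∑ i, ∑ j, ‖e.η i j‖ ^ 2 + 2 * N * ∑ i, ‖e.q i‖ ^ 2 by positivity)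
    have hξ : 0 ≤ ∑ i, ‖e.ξ i‖ ^ 2 := by positivity
    linear_combination (N : ℝ) * hvelocity + hscale + 1 / 2 * hξ
  have hgainθ : 1 + 4 * W ^ 2 * L ^ 2 + s * b ^ 2 + 4 * N * L ^ 2 ≤ 2 * θ * m := by
    have := (div_lt_iff₀ (by positivity)).1 hθ
    linarith
  have hη : 0 ≤ ∑ i, ∑ j, ‖e.η i j‖ ^ 2 := by positivity
  have hp : 0 ≤ ∑ i, ‖e.p i‖ ^ 2 := by positivity
  have hq : 0 ≤ ∑ i, ‖e.q i‖ ^ 2 := by positivity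
  rw [sum_add_distrib] at hobserver
  rw [lyapunovDeriv, normSq, sum_add_distrib]
  dsimp only [vectorField]
  linear_combination hposition + hestimation + hobserver + hcoupling +
    mul_le_mul_of_nonneg_right hgainθ hη + mul_le_mul_of_nonneg_right hσ.le hp +
    mul_le_mul_of_nonneg_right hσ.le hq + (4 * W ^ 2 + 2 * N) * hp

end LoopError

variable [NormedAddCommGroup E] [InnerProductSpace ℝ E]

/-- `S` solves on `[t₀, ∞)` the closed loop with gains `θ`, `σ` of the Nash seeking strategy in
which `F` is the pseudo-gradient, player `i` evaluates `F` at its own estimates `yᵢ`, and `ẑᵢ`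
compensates the disturbance `dᵢ`. -/
structure IsSeekingTrajectory (F : (Fin N → E) → Fin N → E) (A : CommGraph N) (K : FixedGains N)
    (d : Fin N → ℝ → E) (t₀ θ σ : ℝ) (S : ℝ → SeekingState N E) : Prop where
  x_eq : ∀ t, t₀ ≤ t → ∀ i,
    HasDerivWithinAt (fun s => (S s).x i) (-F ((S t).y i) i - (S t).zhat i + d i t) (Set.Ici t₀) t
  y_eq : ∀ t, t₀ ≤ t → ∀ i j,
    HasDerivWithinAt (fun s => (S s).y i j)
      (-((θ * K.thetaBar i j) •
        ((∑ k, A.a i k • ((S t).y i j - (S t).y k j)) + A.a i j • ((S t).y i j - (S t).x j))))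
      (Set.Ici t₀) t
  xhat_eq : ∀ t, t₀ ≤ t → ∀ i,
    HasDerivWithinAt (fun s => (S s).xhat i)
      (-F ((S t).y i) i - (S t).zhat i + (S t).zhat i +
        (σ * K.k₁ i) • ((S t).x i - (S t).xhat i))
      (Set.Ici t₀) t
  zhat_eq : ∀ t, t₀ ≤ t → ∀ i,
    HasDerivWithinAt (fun s => (S s).zhat i)
      ((σ ^ 2 * K.k₂ i) • ((S t).x i - (S t).xhat i)) (Set.Ici t₀) t

variable {F : (Fin N → E) → Fin N → E} {xs : Fin N → E} {A : CommGraph N} {K : FixedGains N}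
  {d : Fin N → ℝ → E} {t₀ θ σ : ℝ} {S : ℝ → SeekingState N E}

theorem IsSeekingTrajectory.hasDerivWithinAt_lyapunov (hS : IsSeekingTrajectory F A K d t₀ θ σ S)
    (hd : ∀ i, DifferentiableOn ℝ (d i) (Set.Ici t₀)) (w : Fin N → ℝ) {t : ℝ} (ht : t₀ ≤ t) :
    HasDerivWithinAt (fun s => ((S s).error σ xs fun i => d i s).lyapunov w K)
      (((S t).error σ xs fun i => d i t).lyapunovDeriv w K
        (((S t).error σ xs fun i => d i t).vectorField F xs A K θ σ
          fun i => derivWithin (d i) (Set.Ici t₀) t)) (Set.Ici t₀) t := by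
  have hvelocity : ∀ i, ((S t).error σ xs fun i => d i t).velocity F xs i =
      -F ((S t).y i) i - (S t).zhat i + d i t := fun i => by
    simp only [LoopError.velocity, SeekingState.error, add_sub_cancel]
    abel
  have hx : ∀ i, HasDerivWithinAt (fun s => (S s).x i)
      (((S t).error σ xs fun i => d i t).velocity F xs i) (Set.Ici t₀) t := fun i => by
    rw [hvelocity]
    exact hS.x_eq t ht i
  refine LoopError.hasDerivWithinAt_lyapunov (fun i => (hx i).sub_const _) (fun i j => ?_)
    (fun i => ?_) fun i => ?_
  · refine ((hS.y_eq t ht i j).sub (hx j)).congr_deriv ?_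
    simp [LoopError.vectorField, SeekingState.error, CommGraph.pinnedLaplacian, add_comm]
  · refine (((hx i).sub (hS.xhat_eq t ht i)).const_smul σ).congr_deriv ?_
    rw [hvelocity]
    simp only [LoopError.vectorField, SeekingState.error]
    module
  · refine ((hd i t ht).hasDerivWithinAt.sub (hS.zhat_eq t ht i)).congr_deriv ?_
    simp only [LoopError.vectorField, SeekingState.error]
    module

theorem SeekingState.normSq_error_one_le (S : SeekingState N E) (hσ : 1 ≤ σ) (xs d : Fin N → E) :
    (S.error 1 xs d).normSq ≤ (S.error σ xs d).normSq := by
  simp only [LoopError.normSq, error, norm_smul, norm_one, one_mul]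
  gcongr
  exact le_mul_of_one_le_left (norm_nonneg _) (hσ.trans (le_abs_self σ))

theorem exists_eventually_normSq_error_le (hN : 2 ≤ N) (hA : A.toSimpleGraph.Connected)
    (K : FixedGains N) {L : ℝ≥0} (hF : LipschitzWith L F) {w : Fin N → ℝ} (hw : ∀ i, 0 < w i)
    (hmono : WeightedStronglyMonotone w F) (hxs : F xs = 0) :
    ∃ θs σs C : ℝ, 0 < θs ∧ 1 ≤ σs ∧ ∀ θ, θs < θ → ∀ σ, σs < σ →
      ∀ (t₀ : ℝ) (d : Fin N → ℝ → E) (M : Fin N → ℝ),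
        (∀ i, DifferentiableOn ℝ (d i) (Set.Ici t₀)) →
        (∀ i t, t₀ ≤ t → ‖derivWithin (d i) (Set.Ici t₀) t‖ ≤ M i) →
        ∀ S, IsSeekingTrajectory F A K d t₀ θ σ S → ∀ r, C * (∑ i, M i ^ 2) / σ < r →
          ∀ᶠ t in atTop, ((S t).error 1 xs fun i => d i t).normSq ≤ r := by
  obtain ⟨θs, σs, D, hθs, hσs, hD, hdecay⟩ :=
    LoopError.exists_lyapunovDeriv_vectorField_le K hN hA hF hw hmono hxs
  obtain ⟨B, hB, hupper⟩ := LoopError.exists_lyapunov_le (E := E) K w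
  obtain ⟨C, hC, hlower⟩ := LoopError.exists_normSq_le_mul_lyapunov (E := E) K hw
  refine ⟨θs, σs, C * (D * B), hθs, hσs, fun θ hθ σ hσ t₀ d M hd hM S hS r hr => ?_⟩
  let e (t : ℝ) : LoopError N E := (S t).error σ xs fun i => d i t
  have hlimit : D * (∑ i, M i ^ 2) / σ / B⁻¹ < r / C := by
    rw [lt_div_iff₀ hC]
    exact hr.trans_eq' (by field_simp)
  have hU := eventually_le_of_hasDerivWithinAt_le_neg_mul_add
    (U := fun t => (e t).lyapunov w K) (inv_pos.2 hB) hlimit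
    (fun t ht => hS.hasDerivWithinAt_lyapunov hd w ht) fun t ht => by
      have hforce : ∑ i, ‖derivWithin (d i) (Set.Ici t₀) t‖ ^ 2 ≤ ∑ i, M i ^ 2 := by
        gcongr with i
        exact hM i t ht
      calc _ ≤ -(e t).normSq + D * (∑ i, ‖derivWithin (d i) (Set.Ici t₀) t‖ ^ 2) / σ :=
            hdecay θ hθ σ hσ _ (e t)
        _ ≤ -B⁻¹ * (e t).lyapunov w K + D * (∑ i, M i ^ 2) / σ := by
            rw [neg_mul]
            gcongr
            · exact (inv_mul_le_iff₀ hB).2 (hupper (e t))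
            · linarith
  filter_upwards [hU] with t ht
  calc ((S t).error 1 xs fun i => d i t).normSq ≤ (e t).normSq :=
        (S t).normSq_error_one_le (hσs.trans hσ.le) xs _
    _ ≤ C * (e t).lyapunov w K := hlower (e t)
    _ ≤ r := (le_div_iff₀' hC).1 ht

end ClosedLoop

theorem corollary2_general {N : ℕ} (hN : 2 ≤ N) {E : Type*} [NormedAddCommGroup E]
    [InnerProductSpace ℝ E] [CompleteSpace E] (Γ : QuadraticGame (Fin N) E) (A : CommGraph N)
    (hA : A.toSimpleGraph.Connected) (K : FixedGains N) (t₀ : ℝ) (d : Fin N → ℝ → E)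
    (hd : ∀ i, DifferentiableOn ℝ (d i) (Set.Ici t₀))
    (hd' : ∀ i, ∃ M : ℝ, ∀ t, t₀ ≤ t → ‖derivWithin (d i) (Set.Ici t₀) t‖ ≤ M) :
    (∃! xs, IsNashEquilibrium Γ.cost xs) ∧
    ∀ xs, IsNashEquilibrium Γ.cost xs →
      ∃ θs : ℝ, 0 < θs ∧ ∀ v₁ : ℝ, 0 < v₁ → ∃ σs : ℝ, 0 < σs ∧
        ∀ θ : ℝ, θs < θ → ∀ σ : ℝ, σs < σ →
          ∀ S, IsSeekingTrajectory (pseudoGradient Γ.cost) A K d t₀ θ σ S →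
            ∃ T : ℝ, t₀ ≤ T ∧ ∀ t : ℝ, T < t →
              √((S t).error 1 xs fun i => d i t).normSq ≤ v₁ := by
  refine ⟨Γ.existsUnique_isNashEquilibrium, fun xs hxs => ?_⟩
  obtain ⟨w, hw, hmono⟩ := Γ.exists_weightedStronglyMonotone_pseudoGradient
  obtain ⟨θs, σs, C, hθs, hσs, hbound⟩ := exists_eventually_normSq_error_le hN hA K
    Γ.lipschitzWith_pseudoGradient hw hmono ((Γ.isNashEquilibrium_iff xs).1 hxs)
  choose M hM using hd'
  refine ⟨θs, hθs, fun v₁ hv₁ => ⟨max σs (C * (∑ i, M i ^ 2) / v₁ ^ 2), by positivity,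
    fun θ hθ σ hσ S hS => ?_⟩⟩
  obtain ⟨hσs', hσv⟩ := max_lt_iff.1 hσ
  have hsmall : C * (∑ i, M i ^ 2) / σ < v₁ ^ 2 :=
    (div_lt_comm₀ (by positivity) (by linarith)).1 hσv
  obtain ⟨T, hT⟩ := eventually_atTop.1 (hbound θ hθ σ hσs' t₀ d M hd hM S hS _ hsmall)
  exact ⟨max t₀ T, le_max_left t₀ T, fun t ht =>
    Real.sqrt_le_iff.2 ⟨hv₁.le, hT t ((le_max_right t₀ T).trans ht.le)⟩⟩

namespace SensorGame

variable {N : ℕ} (G : SensorGame N)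

/-- The sensor game as a quadratic game, with the weights `cᵢⱼ` set to `0` off the physical
neighbours. -/
noncomputable def toQuadraticGame : QuadraticGame (Fin N) Plane where
  quad i := Matrix.toEuclideanCLM (𝕜 := ℝ) (G.quad i)
  lin := G.lin
  const := G.const
  c i j := if j ∈ G.physNbr i then G.c i j else 0
  quad_isSymmetric i := Matrix.isSymmetric_toEuclideanLin_iff.2 (G.quad_posDef i).isHermitian
  quad_coercive i := by
    obtain ⟨m, hm, hle⟩ := exists_pos_mul_dotProduct_le_of_posDef (G.quad_posDef i)
    refine ⟨m, hm, fun v => ?_⟩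
    rw [Matrix.inner_toEuclideanCLM, ← real_inner_self_eq_norm_sq]
    exact (hle v).trans_eq (by simp)
  c_nonneg i j := by
    split_ifs with hj
    exacts [(G.c_pos i j hj).le, le_rfl]

theorem cost_toQuadraticGame : G.toQuadraticGame.cost = G.cost := by
  funext i x
  have hquad : ⟪x i, Matrix.toEuclideanCLM (𝕜 := ℝ) (G.quad i) (x i)⟫_ℝ =
      ∑ k, ∑ l, x i k * G.quad i k l * x i l := by
    simp only [Matrix.inner_toEuclideanCLM, dotProduct, Matrix.mulVec, mul_sum, mul_assoc]
  have hlin : ⟪x i, G.lin i⟫_ℝ = ∑ k, x i k * G.lin i k := by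
    simp [PiLp.inner_apply, mul_comm]
  have hcoupling : ∑ j, (if j ∈ G.physNbr i then G.c i j else 0) * ‖x i - x j‖ ^ 2 =
      ∑ j ∈ G.physNbr i, G.c i j * ‖x i - x j‖ ^ 2 := by
    simp only [ite_mul, zero_mul, sum_ite_mem, univ_inter]
  simp only [QuadraticGame.cost, toQuadraticGame, cost, localCost, hquad, hlin, hcoupling]

end SensorGame

/-- The state of the sensor network as a state of the seeking strategy in `ℝ²`. -/
def LoopState.toSeekingState {N : ℕ} (S : LoopState N) : SeekingState N Plane :=
  ⟨S.x, S.xhat, S.zhat, S.y⟩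

theorem IsTrajectory.isSeekingTrajectory {N : ℕ} {G : SensorGame N} {A : CommGraph N}
    {K : FixedGains N} {d : Fin N → ℝ → Plane} {t₀ θ σ : ℝ} {S : ℝ → LoopState N}
    (hS : IsTrajectory G A K d t₀ θ σ S) :
    IsSeekingTrajectory (pseudoGradient G.cost) A K d t₀ θ σ fun t => (S t).toSeekingState :=
  ⟨hS.x_eq, hS.y_eq, hS.xhat_eq, hS.zhat_eq⟩

theorem norm_errorVec {N : ℕ} (xs : Fin N → Plane) (d : Fin N → ℝ → Plane) (S : ℝ → LoopState N)
    (t : ℝ) : ‖errorVec xs d S t‖ =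
      √((S t).toSeekingState.error 1 xs fun i => d i t).normSq := by
  simp only [errorVec, PiLp.norm_eq_of_L2, Fintype.sum_sum_type, Fintype.sum_prod_type,
    Sum.elim_inl, Sum.elim_inr, LoopError.normSq, SeekingState.error, LoopState.toSeekingState,
    one_smul, sum_add_distrib]
  congr 1
  ring

theorem corollary2 (N : ℕ) (hN : 2 ≤ N)
    (G : SensorGame N) (A : CommGraph N) (hA : A.toSimpleGraph.Connected) (K : FixedGains N)
    (t₀ : ℝ) (d : Fin N → ℝ → Plane)
    (hd : ∀ i, ContDiffOn ℝ 1 (d i) (Set.Ici t₀))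
    (hd' : ∀ i, ∃ M : ℝ, ∀ t, t₀ ≤ t → ‖derivWithin (d i) (Set.Ici t₀) t‖ ≤ M) :
    (∃! xs : Fin N → Plane, G.IsNash xs) ∧
    ∀ xs : Fin N → Plane, G.IsNash xs →
      ∃ θs : ℝ, 0 < θs ∧ ∀ v₁ : ℝ, 0 < v₁ → ∃ σs : ℝ, 0 < σs ∧
        ∀ θ : ℝ, θs < θ → ∀ σ : ℝ, σs < σ →
          ∀ S : ℝ → LoopState N, IsTrajectory G A K d t₀ θ σ S →
            ∃ T : ℝ, t₀ ≤ T ∧ ∀ t : ℝ, T < t → ‖errorVec xs d S t‖ ≤ v₁ := by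
  have hgeneral := corollary2_general hN G.toQuadraticGame A hA K t₀ d
    (fun i => (hd i).differentiableOn one_ne_zero) hd'
  rw [G.cost_toQuadraticGame] at hgeneral
  refine ⟨hgeneral.1, fun xs hxs => ?_⟩
  obtain ⟨θs, hθs, hgain⟩ := hgeneral.2 xs hxs
  refine ⟨θs, hθs, fun v₁ hv₁ => (hgain v₁ hv₁).imp fun σs ⟨hσs, hbound⟩ =>
    ⟨hσs, fun θ hθ σ hσ S hS => ?_⟩⟩
  simpa only [norm_errorVec] using hbound θ hθ σ hσ _ hS.isSeekingTrajectory
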